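/- Let $k\ge 1$ be an integer and write $[n]=\{1,\dots,n\}$. For an integer $n\ge 1$, let $L_n^k$ be the set of $k$-dimensional permutations of order $n$, i.e. of arrays $A:[n]^{k+1}\to\{0,1\}$ such that every line (the set of $n$ positions obtained by fixing $k$ of the coordinates and varying the remaining one) contains exactly one $1$. A monotone subsequence of length $m$ of $A\in L_n^k$ is a sequence $\alpha^1,\dots,\alpha^m\in[n]^{k+1}$ with $A(\alpha^i)=1$ for all $i$ such that, for every $1\le j\le k+1$, the sequence of $j$-th coordinates $\alpha^1_j,\dots,\alpha^m_j$ is strictly monotone (strictly increasing or strictly decreasing, where the direction may depend on $j$). Let $H_n^k$ be the length of the longest monotone subsequence of a uniformly random $A\in L_n^k$. Then, as $n\to\infty$ with $k$ fixed: 1. For every $\varepsilon>0$, $$\Pr\left[H_n^k\, n^{-\frac{k}{k+1}}\in\left[\tfrac{1}{k+2},\,e+\varepsilon\right]\right]\longrightarrow 1 .$$ 2. $$1-\frac{\ln k+1}{k+1}-o(1)\;\le\; E\left[H_n^k\, n^{-\frac{k}{k+1}}\right]\;\le\; e+o(1).$$ -/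

import Mathlib

open Filter Topology MeasureTheory ProbabilityTheory

/-- An `[n]^(k+1)` array with entries in `{0,1}` is a `k`-dimensional permutation of order `n` if
every line contains precisely one `1`.  The line through `x` in direction `j` consists of the
positions `Function.update x j t`, `t ∈ [n]`. -/
def IsHDPerm {n k : ℕ} (A : (Fin (k + 1) → Fin n) → Fin 2) : Prop :=
  ∀ (j : Fin (k + 1)) (x : Fin (k + 1) → Fin n), ∃! t : Fin n, A (Function.update x j t) = 1

/-- The set `L_n^k` of `k`-dimensional permutations of order `n`. -/
def HDPerm (n k : ℕ) : Type :=
  {A : (Fin (k + 1) → Fin n) → Fin 2 // IsHDPerm A}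

namespace HDPerm

variable {n k : ℕ}

instance : Finite (HDPerm n k) :=
  inferInstanceAs (Finite {A : (Fin (k + 1) → Fin n) → Fin 2 // IsHDPerm A})

/-- Every subset of the finite set `L_n^k` is an event. -/
instance : MeasurableSpace (HDPerm n k) := ⊤

/-- The support `G_A`. -/
def support (A : HDPerm n k) : Set (Fin (k + 1) → Fin n) :=
  {x | A.1 x = 1}

/-- `s` is a monotone subsequence of `A` of length `m`: its terms lie in the support of `A`, and
in each coordinate it is strictly increasing or strictly decreasing. -/
def IsMonotoneSubseq (A : HDPerm n k) {m : ℕ} (s : Fin m → Fin (k + 1) → Fin n) : Prop :=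
  (∀ i, s i ∈ A.support) ∧
    ∀ j, StrictMono (fun i => s i j) ∨ StrictAnti (fun i => s i j)

/-- The length of the longest monotone subsequence of `A`. -/
noncomputable def longestMonotone (A : HDPerm n k) : ℕ :=
  sSup {m : ℕ | ∃ s : Fin m → Fin (k + 1) → Fin n, A.IsMonotoneSubseq s}

/-- The set of lengths in `longestMonotone` is bounded, so that the supremum is a maximum. -/
theorem bddAbove_lengths (A : HDPerm n k) :
    BddAbove {m : ℕ | ∃ s : Fin m → Fin (k + 1) → Fin n, A.IsMonotoneSubseq s} := by
  refine ⟨n, ?_⟩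
  rintro m ⟨s, -, hs⟩
  have hinj : Function.Injective (fun i => s i 0) :=
    (hs 0).elim (fun h => h.injective) (fun h => h.injective)
  simpa using Fintype.card_le_of_injective _ hinj

/-- The uniform distribution on `L_n^k`. -/
noncomputable def unif (n k : ℕ) : Measure (HDPerm n k) :=
  uniformOn Set.univ

/-- The random variable `H_n^k * n ^ (-k/(k+1))`. -/
noncomputable def scaledLongest (A : HDPerm n k) : ℝ :=
  (A.longestMonotone : ℝ) * (n : ℝ) ^ (-((k : ℝ) / ((k : ℝ) + 1)))

end HDPerm

/-! Permuting the values within each coordinate is a bijection of $L_n^k$, so the uniform law is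
preserved. By `uniformOn_univ_real_le_of_perm` it suffices to fix an arbitrary $A$ and apply to it a
random member of a finite family of such bijections; nothing about typical $A$ is needed. Write
$y=n^{k/(k+1)}$.

Upper bound: the support has $n^k$ points, hence $n^{km}$ sequences of length $m$. Independent
uniform permutations make a given one monotone, in prescribed directions, with probability at most
$(1/m!)^{k+1}$. The union bound $2^{k+1}(y^m/m!)^{k+1}$ is exponentially small in $y$ once
$m\ge(e+\varepsilon)y$.

Lower bound: give every coordinate value an independent uniform label in $[N]$ and sort each
coordinate by label. One point per occupied label yields an increasing sequence
(`card_occupiedLabels_le_longestMonotone`). With $N\approx by$, the second moment method makes a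
label occupied with probability at least about $1/(1+b^{k+1})$. Occupation of distinct labels is
negatively correlated by FKG, so the number of occupied labels has variance at most $N$ and
Chebyshev applies. The best $b$ gives `secondMomentConst`. -/

/-! ### Random labellings -/

/-- The labels that are the common label of all coordinates of some point of `P`. -/
def occupiedLabels {n k N : ℕ} (P : Finset (Fin (k + 1) → Fin n))
    (c : Fin (k + 1) × Fin n → Fin N) : Finset (Fin N) :=
  {i | ∃ x ∈ P, ∀ j, c (j, x j) = i}

theorem mem_occupiedLabels {n k N : ℕ} {P : Finset (Fin (k + 1) → Fin n)}
    {c : Fin (k + 1) × Fin n → Fin N} {i : Fin N} :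
    i ∈ occupiedLabels P c ↔ ∃ x ∈ P, ∀ j, c (j, x j) = i := by
  simp [occupiedLabels]

/-- Prescribing the labels on $T$ has probability $N^{-|T|}$; multiplying out avoids subtracting
exponents. -/
theorem card_filter_forall_mem_eq {ι : Type*} [Fintype ι] [DecidableEq ι] {N : ℕ} (T : Finset ι)
    (i : Fin N) :
    (({c : ι → Fin N | ∀ a ∈ T, c a = i} : Finset (ι → Fin N)).card : ℝ) * (N : ℝ) ^ T.card =
      (N : ℝ) ^ Fintype.card ι := by
  have h : ({c : ι → Fin N | ∀ a ∈ T, c a = i} : Finset (ι → Fin N)) =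
      Fintype.piFinset (fun a => if a ∈ T then {i} else Finset.univ) := by
    ext c
    simp only [Finset.mem_filter, Finset.mem_univ, true_and, Fintype.mem_piFinset]
    refine forall_congr' fun a => ?_
    by_cases ha : a ∈ T <;> simp [ha]
  rw [h, Fintype.card_piFinset]
  have h2 : ∀ a, (if a ∈ T then ({i} : Finset (Fin N)) else Finset.univ).card =
      if a ∈ T then 1 else N := by
    intro a; split_ifs <;> simp
  simp only [h2]
  rw [Finset.prod_ite]
  have h3 : (Finset.univ.filter (fun a => a ∉ T)) = Tᶜ := by ext; simp
  simp only [Finset.prod_const_one, one_mul, Finset.prod_const, h3]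
  push_cast
  rw [← pow_add, Finset.card_compl_add_card]

section Graph

variable {n k : ℕ}

/-- The coordinate-value pairs of a point. -/
def graphFinset (x : Fin (k + 1) → Fin n) : Finset (Fin (k + 1) × Fin n) :=
  Finset.univ.image fun j => (j, x j)

theorem forall_mem_graphFinset {N : ℕ} {x : Fin (k + 1) → Fin n}
    {c : Fin (k + 1) × Fin n → Fin N} {i : Fin N} :
    (∀ a ∈ graphFinset x, c a = i) ↔ ∀ j, c (j, x j) = i := by
  simp [graphFinset]

theorem card_graphFinset (x : Fin (k + 1) → Fin n) : (graphFinset x).card = k + 1 := by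
  rw [graphFinset, Finset.card_image_of_injective]
  · simp
  · intro a b h
    exact (Prod.ext_iff.1 h).1

/-- Each coordinate where two points agree saves one constraint when both are required to be
monochromatic. -/
theorem card_graphFinset_union (x y : Fin (k + 1) → Fin n) :
    (graphFinset x ∪ graphFinset y).card +
      (Finset.univ.filter fun j => y j = x j).card = (k + 1) + (k + 1) := by
  have h : (graphFinset x ∩ graphFinset y).card = (Finset.univ.filter fun j => y j = x j).card := by
    have : graphFinset x ∩ graphFinset y =
        (Finset.univ.filter fun j => y j = x j).image fun j => (j, x j) := by
      ext ⟨j, t⟩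
      simp only [graphFinset, Finset.mem_inter, Finset.mem_image, Finset.mem_univ, true_and,
        Prod.mk.injEq, Finset.mem_filter]
      constructor
      · rintro ⟨⟨a, rfl, rfl⟩, ⟨b, rfl, hb⟩⟩
        exact ⟨b, hb, rfl, rfl⟩
      · rintro ⟨a, ha, rfl, rfl⟩
        exact ⟨⟨a, rfl, rfl⟩, ⟨a, rfl, ha⟩⟩
    rw [this, Finset.card_image_of_injective]
    intro a b h
    exact (Prod.ext_iff.1 h).1
  rw [← h, Finset.card_union_add_card_inter, card_graphFinset, card_graphFinset]

end Graph

/-! ### Second moment for a single label -/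

section Moments

variable {n k N : ℕ} (P : Finset (Fin (k + 1) → Fin n))

/-- The number of points of `P` all of whose coordinates are labelled `i`. -/
def monochromaticCount (i : Fin N) (c : Fin (k + 1) × Fin n → Fin N) : ℝ :=
  ∑ x ∈ P, if ∀ j, c (j, x j) = i then 1 else 0

theorem sum_monochromaticCount (i : Fin N) (hP : P.card = n ^ k) :
    (∑ c, monochromaticCount P i c) * (N : ℝ) ^ (k + 1) =
      (n : ℝ) ^ k * (N : ℝ) ^ ((k + 1) * n) := by
  unfold monochromaticCount
  rw [Finset.sum_comm, Finset.sum_mul]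
  have : ∀ x ∈ P, (∑ c : Fin (k + 1) × Fin n → Fin N,
      if ∀ j, c (j, x j) = i then (1 : ℝ) else 0) * (N : ℝ) ^ (k + 1) =
        (N : ℝ) ^ ((k + 1) * n) := by
    intro x _
    have h := card_filter_forall_mem_eq (graphFinset x) i
    rw [card_graphFinset] at h
    simp only [forall_mem_graphFinset, Fintype.card_prod, Fintype.card_fin] at h
    rw [Finset.sum_boole, h]
  rw [Finset.sum_congr rfl this, Finset.sum_const, hP]
  simp

theorem sum_monochromaticCount_sq_eq (i : Fin N) (hN : 0 < N) :
    (∑ c, monochromaticCount P i c ^ 2) * (N : ℝ) ^ (2 * (k + 1)) =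
      (N : ℝ) ^ ((k + 1) * n) *
        ∑ x ∈ P, ∑ y ∈ P, (N : ℝ) ^ (Finset.univ.filter fun j => y j = x j).card := by
  have hN' : (N : ℝ) ≠ 0 := by positivity
  unfold monochromaticCount
  simp only [sq, Finset.sum_mul_sum]
  rw [Finset.sum_comm, Finset.sum_mul, Finset.mul_sum]
  refine Finset.sum_congr rfl fun x _ => ?_
  rw [Finset.sum_comm, Finset.sum_mul, Finset.mul_sum]
  refine Finset.sum_congr rfl fun y _ => ?_
  have h := card_filter_forall_mem_eq (graphFinset x ∪ graphFinset y) i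
  simp only [Finset.forall_mem_union, forall_mem_graphFinset, Fintype.card_prod,
    Fintype.card_fin] at h
  have h2 := card_graphFinset_union x y
  rw [← h]
  simp only [← ite_and, mul_ite, mul_one, mul_zero]
  rw [Finset.sum_boole, mul_assoc, ← pow_add, h2]
  congr 2
  · congr 2
    ext c
    simp [and_comm]
  · ring

/-- Bounding the term of the exact agreement set by a sum over all its subsets $S$ needs only upper
counts of points agreeing with $x$ on $S$; the proper subsets then form part of a binomial
expansion. -/
theorem sum_pow_card_agree_le (hn : 0 < n) {x : Fin (k + 1) → Fin n}
    (hx : ∀ S : Finset (Fin (k + 1)), S ≠ Finset.univ →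
      (P.filter fun y => ∀ j ∈ S, y j = x j).card * n ^ S.card ≤ n ^ k) :
    ∑ y ∈ P, (N : ℝ) ^ (Finset.univ.filter fun j => y j = x j).card ≤
      (N : ℝ) ^ (k + 1) + (n : ℝ) ^ k * (1 + (N : ℝ) / n) ^ (k + 1) := by
  have hn' : (0 : ℝ) < n := by exact_mod_cast hn
  calc ∑ y ∈ P, (N : ℝ) ^ (Finset.univ.filter fun j => y j = x j).card
      ≤ ∑ y ∈ P, ∑ S : Finset (Fin (k + 1)),
          if ∀ j ∈ S, y j = x j then (N : ℝ) ^ S.card else 0 := by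
        refine Finset.sum_le_sum fun y _ => ?_
        have := Finset.single_le_sum (f := fun S : Finset (Fin (k + 1)) =>
          if ∀ j ∈ S, y j = x j then (N : ℝ) ^ S.card else 0)
          (fun S _ => by positivity)
          (Finset.mem_univ (Finset.univ.filter fun j => y j = x j))
        refine le_trans (le_of_eq ?_) this
        simp
    _ = ∑ S : Finset (Fin (k + 1)),
          ((P.filter fun y => ∀ j ∈ S, y j = x j).card : ℝ) * (N : ℝ) ^ S.card := by
        rw [Finset.sum_comm]
        refine Finset.sum_congr rfl fun S _ => ?_
        rw [← Finset.sum_filter, Finset.sum_const, nsmul_eq_mul]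
    _ ≤ (N : ℝ) ^ (k + 1) +
          ∑ S ∈ Finset.univ.erase (Finset.univ : Finset (Fin (k + 1))),
            (n : ℝ) ^ k * ((N : ℝ) / n) ^ S.card := by
        rw [← Finset.add_sum_erase _ _ (Finset.mem_univ (Finset.univ : Finset (Fin (k + 1))))]
        refine add_le_add ?_ (Finset.sum_le_sum fun S hS => ?_)
        · have h1 : (P.filter fun y => ∀ j ∈ (Finset.univ : Finset (Fin (k + 1))), y j = x j).card
              ≤ 1 := by
            rw [Finset.card_le_one]
            intro a ha b hb
            simp only [Finset.mem_filter, Finset.mem_univ, true_imp_iff] at ha hb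
            funext j
            rw [ha.2 j, hb.2 j]
          have h1' : ((P.filter fun y => ∀ j ∈ (Finset.univ : Finset (Fin (k + 1))),
            y j = x j).card : ℝ) ≤ 1 := by exact_mod_cast h1
          simp only [Finset.card_univ, Fintype.card_fin] at h1' ⊢
          exact mul_le_of_le_one_left (by positivity) h1'
        · have h := hx S (Finset.ne_of_mem_erase hS)
          have h' : ((P.filter fun y => ∀ j ∈ S, y j = x j).card : ℝ) * (n : ℝ) ^ S.card ≤
            (n : ℝ) ^ k := by exact_mod_cast h
          rw [div_pow, ← mul_div_assoc, le_div_iff₀ (by positivity)]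
          calc _ = ((P.filter fun y => ∀ j ∈ S, y j = x j).card : ℝ) * (n : ℝ) ^ S.card *
                (N : ℝ) ^ S.card := by ring
            _ ≤ _ := by gcongr
    -- Restoring the term $S$ = `univ` completes the binomial sum.
    _ ≤ (N : ℝ) ^ (k + 1) + ∑ S : Finset (Fin (k + 1)),
            (n : ℝ) ^ k * ((N : ℝ) / n) ^ S.card := by
        gcongr
        exact Finset.erase_subset _ _
    _ = _ := by
        rw [← Finset.mul_sum]
        have := Fintype.sum_pow_mul_eq_add_pow (Fin (k + 1)) ((N : ℝ) / n) 1
        simp only [one_pow, mul_one, Fintype.card_fin] at this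
        rw [this, add_comm ((N : ℝ) / n)]

/-- Second moment bound for the probability that a label is occupied. -/
theorem le_card_filter_mem_occupiedLabels (hn : 0 < n) (i : Fin N) (hP : P.card = n ^ k)
    (hx : ∀ x ∈ P, ∀ S : Finset (Fin (k + 1)), S ≠ Finset.univ →
      (P.filter fun y => ∀ j ∈ S, y j = x j).card * n ^ S.card ≤ n ^ k) :
    (n : ℝ) ^ k / ((N : ℝ) ^ (k + 1) + (n : ℝ) ^ k * (1 + (N : ℝ) / n) ^ (k + 1)) *
        (N : ℝ) ^ ((k + 1) * n) ≤
      ((Finset.univ.filter fun c : Fin (k + 1) × Fin n → Fin N =>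
        i ∈ occupiedLabels P c).card : ℝ) := by
  have hN : 0 < N := i.pos
  have hn' : (0 : ℝ) < n := by exact_mod_cast hn
  have hN' : (0 : ℝ) < N := by exact_mod_cast hN
  set D : ℝ := (N : ℝ) ^ (k + 1) + (n : ℝ) ^ k * (1 + (N : ℝ) / n) ^ (k + 1) with hD
  set M : ℝ := (N : ℝ) ^ ((k + 1) * n) with hM
  have hDpos : 0 < D := by positivity
  have hMpos : 0 < M := by positivity
  set a : ℝ := ((Finset.univ.filter fun c : Fin (k + 1) × Fin n → Fin N =>
        i ∈ occupiedLabels P c).card : ℝ) with ha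
  -- Cauchy–Schwarz for the occupation indicator times the count, which equals the count.
  have hCS := Finset.sum_mul_sq_le_sq_mul_sq Finset.univ
    (fun c : Fin (k + 1) × Fin n → Fin N => if i ∈ occupiedLabels P c then (1 : ℝ) else 0)
    (monochromaticCount P i)
  have e1 : ∀ c : Fin (k + 1) × Fin n → Fin N,
      (if i ∈ occupiedLabels P c then (1 : ℝ) else 0) * monochromaticCount P i c =
        monochromaticCount P i c := by
    intro c
    split_ifs with h
    · simp
    · rw [zero_mul, monochromaticCount]
      symm
      refine Finset.sum_eq_zero fun x hxP => if_neg fun hc => h ?_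
      exact mem_occupiedLabels.2 ⟨x, hxP, hc⟩
  have e2 : ∑ c : Fin (k + 1) × Fin n → Fin N,
      (if i ∈ occupiedLabels P c then (1 : ℝ) else 0) ^ 2 = a := by
    simp only [ite_pow, one_pow, ne_eq, OfNat.ofNat_ne_zero, not_false_eq_true, zero_pow]
    rw [Finset.sum_boole]
  simp only [e1, e2] at hCS
  have h1 := sum_monochromaticCount (N := N) P i hP
  have h2 := sum_monochromaticCount_sq_eq (N := N) P i hN
  have h3 : ∑ x ∈ P, ∑ y ∈ P, (N : ℝ) ^ (Finset.univ.filter fun j => y j = x j).card ≤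
      (n : ℝ) ^ k * D := by
    calc _ ≤ ∑ x ∈ P, D := Finset.sum_le_sum fun x hxP => sum_pow_card_agree_le P hn (hx x hxP)
      _ = _ := by rw [Finset.sum_const, hP]; simp
  set s1 := ∑ c, monochromaticCount (N := N) P i c
  set s2 := ∑ c, monochromaticCount (N := N) P i c ^ 2
  have h4 : ((n : ℝ) ^ k * M) ^ 2 ≤ a * (M * ((n : ℝ) ^ k * D)) := by
    calc ((n : ℝ) ^ k * M) ^ 2 = s1 ^ 2 * (N : ℝ) ^ (2 * (k + 1)) := by rw [← h1]; ring
      _ ≤ (a * s2) * (N : ℝ) ^ (2 * (k + 1)) := by gcongr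
      _ = a * (s2 * (N : ℝ) ^ (2 * (k + 1))) := by ring
      _ ≤ _ := by
        rw [h2]
        gcongr
  rw [div_mul_eq_mul_div, div_le_iff₀ hDpos]
  have hpos : 0 < (n : ℝ) ^ k * M := by positivity
  refine le_of_mul_le_mul_right ?_ hpos
  nlinarith [h4]

end Moments

/-! ### Negative correlation and concentration -/

section Correlation

variable {n k N : ℕ} (P : Finset (Fin (k + 1) → Fin n))

theorem mem_occupiedLabels_perm_comp (e : Equiv.Perm (Fin N)) (c : Fin (k + 1) × Fin n → Fin N)
    (i : Fin N) : e i ∈ occupiedLabels P (e ∘ c) ↔ i ∈ occupiedLabels P c := by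
  simp [mem_occupiedLabels]

theorem exists_perm_apply_eq_apply_eq {α : Type*} [DecidableEq α] {a b a' b' : α} (h : a ≠ b)
    (h' : a' ≠ b') : ∃ e : Equiv.Perm α, e a = a' ∧ e b = b' := by
  refine ⟨Equiv.swap (Equiv.swap a a' b) b' * Equiv.swap a a', ?_, by simp⟩
  rw [Equiv.Perm.mul_apply, Equiv.swap_apply_left, Equiv.swap_apply_of_ne_of_ne _ h']
  intro hh
  apply h
  apply (Equiv.swap a a').injective
  rw [← hh, Equiv.swap_apply_left]

/-- In the pointwise order on labellings, occupation of the least label is a decreasing event and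
occupation of the greatest an increasing one, so FKG makes them negatively correlated. -/
theorem card_occupiedLabels_zero_last_le {N : ℕ} :
    (Finset.univ.filter fun c : Fin (k + 1) × Fin n → Fin (N + 2) =>
        0 ∈ occupiedLabels P c ∧ Fin.last (N + 1) ∈ occupiedLabels P c).card *
        (N + 2) ^ ((k + 1) * n) ≤
      (Finset.univ.filter fun c : Fin (k + 1) × Fin n → Fin (N + 2) =>
        0 ∈ occupiedLabels P c).card *
      (Finset.univ.filter fun c : Fin (k + 1) × Fin n → Fin (N + 2) =>
        Fin.last (N + 1) ∈ occupiedLabels P c).card := by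
  -- Both functions must be increasing, so the complement is used for label $0$; the weight is
  -- constant.
  have h := fkg (α := Fin (k + 1) × Fin n → Fin (N + 2)) (β := ℕ)
    (fun c => if 0 ∈ occupiedLabels P c then 0 else 1)
    (fun c => if Fin.last (N + 1) ∈ occupiedLabels P c then 1 else 0)
    (fun _ => 1) (fun _ => zero_le_one) (fun _ => Nat.zero_le _) (fun _ => Nat.zero_le _) ?_ ?_
    (fun _ _ => le_rfl)
  · have hprod : ∀ c : Fin (k + 1) × Fin n → Fin (N + 2),
        (if 0 ∈ occupiedLabels P c then 0 else 1) *
          (if Fin.last (N + 1) ∈ occupiedLabels P c then 1 else 0) =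
        if (¬ 0 ∈ occupiedLabels P c ∧ Fin.last (N + 1) ∈ occupiedLabels P c) then 1 else 0 := by
      intro c
      by_cases h0 : 0 ∈ occupiedLabels P c <;> simp [h0]
    have hneg : ∀ c : Fin (k + 1) × Fin n → Fin (N + 2),
        (if 0 ∈ occupiedLabels P c then 0 else 1) =
        if ¬ 0 ∈ occupiedLabels P c then 1 else 0 := by
      intro c
      by_cases h0 : 0 ∈ occupiedLabels P c <;> simp [h0]
    simp only [one_mul, hprod] at h
    simp only [hneg, Finset.sum_boole, Nat.cast_id, Finset.sum_const, Finset.card_univ,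
      Fintype.card_pi, Fintype.card_fin, Finset.prod_const, Fintype.card_prod, smul_eq_mul,
      mul_one] at h
    have hA := Finset.card_filter_add_card_filter_not
      (s := (Finset.univ : Finset (Fin (k + 1) × Fin n → Fin (N + 2))))
      (fun c => 0 ∈ occupiedLabels P c)
    have hB := Finset.card_filter_add_card_filter_not
      (s := (Finset.univ.filter fun c : Fin (k + 1) × Fin n → Fin (N + 2) =>
        Fin.last (N + 1) ∈ occupiedLabels P c))
      (fun c => 0 ∈ occupiedLabels P c)
    simp only [Finset.filter_filter, Finset.card_univ, Fintype.card_pi, Fintype.card_fin,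
      Finset.prod_const, Fintype.card_prod] at hA hB
    simp only [and_comm (a := Fin.last (N + 1) ∈ _)] at hB
    rw [← hA] at h ⊢
    nlinarith [h, hA, hB]
  · intro c c' hc
    dsimp only
    split_ifs with h1 h2 <;> try simp
    obtain ⟨x, hx, hxc⟩ := mem_occupiedLabels.1 ‹0 ∈ occupiedLabels P c'›
    refine absurd (mem_occupiedLabels.2 ⟨x, hx, fun j => ?_⟩) h1
    exact le_antisymm ((hc _).trans (hxc j).le) (Fin.zero_le _)
  · intro c c' hc
    dsimp only
    split_ifs with h1 h2 <;> try simp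
    obtain ⟨x, hx, hxc⟩ := mem_occupiedLabels.1 h1
    refine absurd (mem_occupiedLabels.2 ⟨x, hx, fun j => ?_⟩) h2
    exact le_antisymm (Fin.le_last _) ((hxc j).symm.le.trans (hc _))

/-- Occupation of distinct labels is negatively correlated. -/
theorem card_occupiedLabels_pair_le {i i' : Fin N} (hi : i ≠ i') :
    (Finset.univ.filter fun c : Fin (k + 1) × Fin n → Fin N =>
        i ∈ occupiedLabels P c ∧ i' ∈ occupiedLabels P c).card * N ^ ((k + 1) * n) ≤
      (Finset.univ.filter fun c : Fin (k + 1) × Fin n → Fin N => i ∈ occupiedLabels P c).card *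
      (Finset.univ.filter fun c : Fin (k + 1) × Fin n → Fin N => i' ∈ occupiedLabels P c).card := by
  obtain _ | _ | N := N
  · exact i.elim0
  · exact absurd (Subsingleton.elim (α := Fin 1) i i') hi
  -- Relabelling by `e` moves the pair to the extreme labels without changing any count.
  · obtain ⟨e, he, he'⟩ := exists_perm_apply_eq_apply_eq hi
      (show (0 : Fin (N + 2)) ≠ Fin.last (N + 1) from (Fin.last_pos).ne)
    have key : ∀ (p q : (Fin (k + 1) × Fin n → Fin (N + 2)) → Prop) [DecidablePred p]
        [DecidablePred q], (∀ c, q (e ∘ c) ↔ p c) →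
        (Finset.univ.filter p).card = (Finset.univ.filter q).card := by
      intro p q _ _ hpq
      refine Finset.card_bijective (fun c => e ∘ c)
        (Equiv.arrowCongr (Equiv.refl _) e).bijective fun c => ?_
      simp [hpq]
    have := card_occupiedLabels_zero_last_le (N := N) P
    rw [← he, ← he'] at this
    rw [key (fun c => i ∈ occupiedLabels P c ∧ i' ∈ occupiedLabels P c)
        (fun c => e i ∈ occupiedLabels P c ∧ e i' ∈ occupiedLabels P c)
        (fun c => by rw [mem_occupiedLabels_perm_comp, mem_occupiedLabels_perm_comp]),
      key (fun c => i ∈ occupiedLabels P c) (fun c => e i ∈ occupiedLabels P c)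
        (fun c => by rw [mem_occupiedLabels_perm_comp]),
      key (fun c => i' ∈ occupiedLabels P c) (fun c => e i' ∈ occupiedLabels P c)
        (fun c => by rw [mem_occupiedLabels_perm_comp])]
    exact this

/-- Variance bound for the number of occupied labels, in Chebyshev form. -/
theorem card_filter_card_occupiedLabels_lt (hN : 0 < N) {q δ : ℝ} (hδ : 0 < δ)
    (hq : ∀ i : Fin N, q * (N : ℝ) ^ ((k + 1) * n) ≤
      ((Finset.univ.filter fun c : Fin (k + 1) × Fin n → Fin N =>
        i ∈ occupiedLabels P c).card : ℝ)) :
    ((Finset.univ.filter fun c : Fin (k + 1) × Fin n → Fin N =>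
        ((occupiedLabels P c).card : ℝ) < N * (q - δ)).card : ℝ) ≤
      1 / (N * δ ^ 2) * (N : ℝ) ^ ((k + 1) * n) := by
  have hN' : (0 : ℝ) < N := by exact_mod_cast hN
  set M : ℝ := (N : ℝ) ^ ((k + 1) * n) with hM
  have hMpos : 0 < M := by positivity
  set a : Fin N → ℝ := fun i => ((Finset.univ.filter fun c : Fin (k + 1) × Fin n → Fin N =>
        i ∈ occupiedLabels P c).card : ℝ) with ha
  set Z : (Fin (k + 1) × Fin n → Fin N) → ℝ := fun c => ((occupiedLabels P c).card : ℝ) with hZ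
  have hcardM : ∑ _c : Fin (k + 1) × Fin n → Fin N, (1 : ℝ) = M := by
    simp [hM]
  have hZeq : ∀ c, Z c = ∑ i, if i ∈ occupiedLabels P c then (1 : ℝ) else 0 := by
    intro c
    rw [Finset.sum_boole]
    simp [hZ]
  have haM : ∀ i, a i ≤ M := by
    intro i
    rw [← hcardM]
    simp only [ha, Finset.sum_const, nsmul_eq_mul, mul_one]
    exact_mod_cast Finset.card_le_card (Finset.filter_subset _ _)
  have hsum1 : ∑ c, Z c = ∑ i, a i := by
    simp only [hZeq]
    rw [Finset.sum_comm]
    refine Finset.sum_congr rfl fun i _ => ?_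
    rw [Finset.sum_boole]
  set S := ∑ i, a i with hS
  -- Off-diagonal pairs are absorbed in $S^2$ by negative correlation; each of the $N$ diagonal
  -- terms costs at most $M^2$.
  have hsum2 : (∑ c, Z c ^ 2) * M ≤ S ^ 2 + N * M * M := by
    have : ∑ c, Z c ^ 2 = ∑ i, ∑ i', ((Finset.univ.filter
        fun c : Fin (k + 1) × Fin n → Fin N =>
          i ∈ occupiedLabels P c ∧ i' ∈ occupiedLabels P c).card : ℝ) := by
      simp only [hZeq, sq, Finset.sum_mul_sum]
      rw [Finset.sum_comm]
      refine Finset.sum_congr rfl fun i _ => ?_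
      rw [Finset.sum_comm]
      refine Finset.sum_congr rfl fun i' _ => ?_
      simp only [mul_ite, mul_one, mul_zero, ← ite_and]
      rw [Finset.sum_boole]
      congr 2
      ext c
      simp [and_comm]
    rw [this, hS, sq, Finset.sum_mul_sum, Finset.sum_mul]
    have hNN : (N : ℝ) * M * M = ∑ i : Fin N, M * M := by simp [mul_assoc]
    rw [hNN, ← Finset.sum_add_distrib]
    refine Finset.sum_le_sum fun i _ => ?_
    rw [Finset.sum_mul]
    have hdiag : M * M = ∑ i' : Fin N, if i' = i then M * M else 0 := by simp
    rw [hdiag, ← Finset.sum_add_distrib]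
    refine Finset.sum_le_sum fun i' _ => ?_
    by_cases h : i' = i
    · subst h
      have h1 := haM i'
      have h0 : 0 ≤ a i' := Nat.cast_nonneg _
      simp only [and_self, if_true]
      calc a i' * M ≤ M * M := by gcongr
        _ ≤ a i' * a i' + M * M := le_add_of_nonneg_left (mul_nonneg h0 h0)
    · rw [if_neg h, add_zero]
      have := card_occupiedLabels_pair_le P (Ne.symm h)
      have h' : _ := (Nat.cast_le (α := ℝ)).2 this
      push_cast at h'
      exact h'
  have hvar : ∑ c, (Z c - S / M) ^ 2 ≤ N * M := by
    have : ∑ c, (Z c - S / M) ^ 2 = ∑ c, Z c ^ 2 - S ^ 2 / M := by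
      have e : ∀ c, (Z c - S / M) ^ 2 = Z c ^ 2 - 2 * (S / M) * Z c + (S / M) ^ 2 * 1 := by
        intro c; ring
      simp only [e]
      rw [Finset.sum_add_distrib, Finset.sum_sub_distrib, ← Finset.mul_sum, ← Finset.mul_sum,
        hcardM, hsum1]
      field_simp
      ring
    rw [this, sub_le_iff_le_add, ← mul_le_mul_iff_left₀ hMpos]
    calc _ ≤ _ := hsum2
      _ = _ := by field_simp; ring
  have hSq : N * q ≤ S / M := by
    rw [le_div_iff₀ hMpos]
    calc N * q * M = ∑ i : Fin N, q * M := by simp [mul_assoc]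
      _ ≤ _ := Finset.sum_le_sum fun i _ => hq i
  -- The mean $S/M$ is at least $Nq$, so these labellings deviate from it by at least $N\delta$.
  have hcheb : ((Finset.univ.filter fun c => Z c < N * (q - δ)).card : ℝ) * (N * δ) ^ 2 ≤
      N * M := by
    refine le_trans ?_ hvar
    rw [← nsmul_eq_mul, ← Finset.sum_const]
    refine le_trans (Finset.sum_le_sum (g := fun c => (Z c - S / M) ^ 2) fun c hc => ?_)
      (Finset.sum_le_univ_sum_of_nonneg fun c => sq_nonneg _)
    have hc' : Z c < N * (q - δ) := (Finset.mem_filter.1 hc).2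
    rw [← neg_sq (Z c - S / M)]
    refine pow_le_pow_left₀ (by positivity) ?_ 2
    linarith
  rw [one_div, inv_mul_eq_div, le_div_iff₀ (by positivity)]
  refine le_of_mul_le_mul_right ?_ hN'
  calc _ = ((Finset.univ.filter fun c => Z c < N * (q - δ)).card : ℝ) * (N * δ) ^ 2 := by ring
    _ ≤ _ := hcheb
    _ = _ := by ring

end Correlation

/-! ### Averaging over bijections -/

section Averaging

variable {X : Type*} [Fintype X] [MeasurableSpace X] [MeasurableSingletonClass X]

theorem uniformOn_univ_real (S : Set X) [DecidablePred (· ∈ S)] :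
    (uniformOn (Set.univ : Set X)).real S =
      ((Finset.univ.filter (· ∈ S)).card : ℝ) / Fintype.card X := by
  rw [measureReal_def, uniformOn_univ,
    Measure.count_apply_finite S (Set.toFinite S), ENNReal.toReal_div]
  simp only [ENNReal.toReal_natCast]
  congr 3
  ext x
  simp

/-- If every point is moved into `S` by at most a proportion `η` of a finite family of
permutations, then `S` has probability at most `η` under the uniform distribution. -/
theorem uniformOn_univ_real_le_of_perm {Ω : Type*} [Fintype Ω] [Nonempty Ω]
    (φ : Ω → Equiv.Perm X) (S : Set X) [DecidablePred (· ∈ S)] {η : ℝ} (hη : 0 ≤ η)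
    (h : ∀ x, ((Finset.univ.filter fun ω => φ ω x ∈ S).card : ℝ) ≤ η * Fintype.card Ω) :
    (uniformOn (Set.univ : Set X)).real S ≤ η := by
  rw [uniformOn_univ_real]
  refine div_le_of_le_mul₀ (Nat.cast_nonneg _) hη ?_
  have hΩ : (0 : ℝ) < Fintype.card Ω := by exact_mod_cast Fintype.card_pos
  refine le_of_mul_le_mul_right ?_ hΩ
  calc ((Finset.univ.filter (· ∈ S)).card : ℝ) * Fintype.card Ω
      = ∑ ω : Ω, ∑ x : X, if φ ω x ∈ S then (1 : ℝ) else 0 := by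
        -- Double counting: for each fixed $\omega$ the bijection leaves the count of $S$ unchanged.
        have : ∀ ω : Ω, (∑ x : X, if φ ω x ∈ S then (1 : ℝ) else 0) =
            ((Finset.univ.filter (· ∈ S)).card : ℝ) := by
          intro ω
          rw [Equiv.sum_comp (φ ω) (fun x => if x ∈ S then (1 : ℝ) else 0), Finset.sum_boole]
        simp [this, mul_comm]
    _ = ∑ x : X, ((Finset.univ.filter fun ω => φ ω x ∈ S).card : ℝ) := by
        rw [Finset.sum_comm]
        simp only [Finset.sum_boole]
    _ ≤ ∑ _x : X, η * Fintype.card Ω := Finset.sum_le_sum fun x _ => h x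
    _ = _ := by simp; ring

end Averaging

/-! ### Supports, relabelling and sorting -/

namespace HDPerm

variable {n k : ℕ}

/-- The support as a finite set. -/
def supportFinset (A : HDPerm n k) : Finset (Fin (k + 1) → Fin n) :=
  Finset.univ.filter fun x => A.1 x = 1

theorem mem_supportFinset {A : HDPerm n k} {x : Fin (k + 1) → Fin n} :
    x ∈ A.supportFinset ↔ x ∈ A.support := by
  simp [supportFinset, support]

theorem eq_of_mem_support {A : HDPerm n k} {x y : Fin (k + 1) → Fin n} (hx : x ∈ A.support)
    (hy : y ∈ A.support) (j : Fin (k + 1)) (h : ∀ i, i ≠ j → x i = y i) : x = y := by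
  have hxy : x = Function.update y j (x j) := by
    funext i
    by_cases hi : i = j
    · subst hi; simp
    · simp [hi, h i hi]
  have hu := (A.2 j y).unique (y₁ := x j) (y₂ := y j)
    (by rw [← hxy]; exact hx) (by rw [Function.update_eq_self]; exact hy)
  rw [hxy, hu, Function.update_eq_self]

theorem card_supportFinset (hn : 0 < n) (A : HDPerm n k) : A.supportFinset.card = n ^ k := by
  have hc : Fintype.card (Fin k → Fin n) = n ^ k := by simp
  rw [← hc, ← Finset.card_univ]
  refine Finset.card_bij (fun x _ => Fin.tail x) (fun _ _ => Finset.mem_univ _) ?_ ?_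
  · intro x hx y hy h
    refine eq_of_mem_support (mem_supportFinset.1 hx) (mem_supportFinset.1 hy) 0 fun i hi => ?_
    obtain ⟨i, rfl⟩ := Fin.exists_succ_eq.2 hi
    exact congrFun h i
  · intro r _
    obtain ⟨t, ht, -⟩ := A.2 0 (Fin.cons ⟨0, hn⟩ r)
    refine ⟨Fin.cons t r, mem_supportFinset.2 ?_, Fin.tail_cons _ _⟩
    simpa [support] using ht

/-- With $j\notin S$, a support point prescribed on $S$ is determined by its coordinates outside
$S\cup\{j\}$, since the remaining one lies on a line. -/
theorem card_filter_supportFinset_mul_le (A : HDPerm n k) (x : Fin (k + 1) → Fin n)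
    {S : Finset (Fin (k + 1))} (hS : S ≠ Finset.univ) :
    (A.supportFinset.filter fun y => ∀ j ∈ S, y j = x j).card * n ^ S.card ≤ n ^ k := by
  obtain ⟨j, hj⟩ : ∃ j, j ∉ S := by
    by_contra! h
    exact hS (Finset.eq_univ_iff_forall.2 h)
  have hcard : (A.supportFinset.filter fun y => ∀ j ∈ S, y j = x j).card ≤
      Fintype.card ({i // i ∉ insert j S} → Fin n) := by
    rw [← Finset.card_univ]
    refine Finset.card_le_card_of_injOn (fun y i => y i.1) (fun _ _ => Finset.mem_univ _) ?_
    intro y hy z hz hyz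
    simp only [Finset.coe_filter, Set.mem_ofPred_eq, mem_supportFinset] at hy hz
    refine eq_of_mem_support hy.1 hz.1 j fun i hi => ?_
    by_cases hiS : i ∈ S
    · rw [hy.2 i hiS, hz.2 i hiS]
    · exact congrFun hyz ⟨i, by simp [hi, hiS]⟩
  have hc : Fintype.card {i // i ∉ insert j S} + S.card = k := by
    have h1 : Fintype.card {i // i ∉ insert j S} = (insert j S)ᶜ.card := by
      rw [Fintype.card_subtype]
      congr 1
      ext; simp
    have h2 := Finset.card_compl_add_card (insert j S)
    rw [Finset.card_insert_of_notMem hj, Fintype.card_fin] at h2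
    omega
  calc _ ≤ Fintype.card ({i // i ∉ insert j S} → Fin n) * n ^ S.card := by gcongr
    _ = n ^ k := by
      rw [Fintype.card_fun, Fintype.card_fin, ← pow_add, hc]

/-- Relabelling the values of each coordinate. -/
def permute (π : Fin (k + 1) → Equiv.Perm (Fin n)) : Equiv.Perm (HDPerm n k) where
  toFun A := ⟨fun x => A.1 fun j => (π j).symm (x j), by
    intro j x
    have h : ∀ t, (fun i => (π i).symm (Function.update x j t i)) =
        Function.update (fun i => (π i).symm (x i)) j ((π j).symm t) := by
      intro t
      funext i
      by_cases hi : i = j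
      · subst hi; simp
      · simp [hi]
    obtain ⟨t, ht, hu⟩ := A.2 j fun i => (π i).symm (x i)
    refine ⟨π j t, ?_, ?_⟩
    · change A.1 _ = 1
      rw [h]
      simpa using ht
    · intro s hs
      change A.1 _ = 1 at hs
      rw [h] at hs
      rw [← hu _ hs, Equiv.apply_symm_apply]⟩
  invFun A := ⟨fun x => A.1 fun j => π j (x j), by
    intro j x
    have h : ∀ t, (fun i => π i (Function.update x j t i)) =
        Function.update (fun i => π i (x i)) j (π j t) := by
      intro t
      funext i
      by_cases hi : i = j
      · subst hi; simp
      · simp [hi]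
    obtain ⟨t, ht, hu⟩ := A.2 j fun i => π i (x i)
    refine ⟨(π j).symm t, ?_, ?_⟩
    · change A.1 _ = 1
      rw [h]
      simpa using ht
    · intro s hs
      change A.1 _ = 1 at hs
      rw [h] at hs
      rw [← hu _ hs, Equiv.symm_apply_apply]⟩
  left_inv A := by
    apply Subtype.ext
    funext x
    simp
  right_inv A := by
    apply Subtype.ext
    funext x
    simp

theorem mem_support_permute {π : Fin (k + 1) → Equiv.Perm (Fin n)} {A : HDPerm n k}
    {x : Fin (k + 1) → Fin n} :
    x ∈ (permute π A).support ↔ (fun j => (π j).symm (x j)) ∈ A.support :=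
  Iff.rfl

theorem le_longestMonotone (A : HDPerm n k) {m : ℕ} {s : Fin m → Fin (k + 1) → Fin n}
    (hs : A.IsMonotoneSubseq s) : m ≤ A.longestMonotone :=
  le_csSup A.bddAbove_lengths ⟨s, hs⟩

theorem exists_isMonotoneSubseq_of_le (A : HDPerm n k) {m : ℕ} (hm : m ≤ A.longestMonotone) :
    ∃ s : Fin m → Fin (k + 1) → Fin n, A.IsMonotoneSubseq s := by
  have hne : {m : ℕ | ∃ s : Fin m → Fin (k + 1) → Fin n, A.IsMonotoneSubseq s}.Nonempty := by
    refine ⟨0, fun i => i.elim0, fun i => i.elim0, fun j => Or.inl fun i => i.elim0⟩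
  obtain ⟨s, hs, hmono⟩ := Nat.sSup_mem hne A.bddAbove_lengths
  refine ⟨fun i => s (Fin.castLE hm i), fun i => hs _, fun j => (hmono j).imp ?_ ?_⟩
  · intro h a b hab
    exact h (Fin.castLE_lt_castLE_iff hm |>.2 hab)
  · intro h a b hab
    exact h (Fin.castLE_lt_castLE_iff hm |>.2 hab)

theorem longestMonotone_le (A : HDPerm n k) : A.longestMonotone ≤ n := by
  obtain ⟨s, -, hs⟩ := A.exists_isMonotoneSubseq_of_le le_rfl
  have hinj : Function.Injective (fun i => s i 0) :=
    (hs 0).elim (fun h => h.injective) (fun h => h.injective)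
  simpa using Fintype.card_le_of_injective _ hinj

/-- Sort each coordinate according to the labels. -/
def sortPerm {N : ℕ} (c : Fin (k + 1) × Fin n → Fin N) (j : Fin (k + 1)) :
    Equiv.Perm (Fin n) :=
  (Tuple.sort fun a => c (j, a)).symm

/-- `Tuple.sort` maps ranks to values, so its inverse maps values to ranks; the order within one
label is immaterial. -/
theorem sortPerm_lt {N : ℕ} (c : Fin (k + 1) × Fin n → Fin N) (j : Fin (k + 1)) {a b : Fin n}
    (h : c (j, a) < c (j, b)) : sortPerm c j a < sortPerm c j b := by
  by_contra! hle
  have := Tuple.monotone_sort (fun a => c (j, a)) hle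
  simp only [sortPerm, Function.comp_apply, Equiv.apply_symm_apply] at this
  exact absurd h this.not_gt

/-- One support point is chosen per occupied label and listed in label order; sorting makes every
coordinate increase. -/
theorem card_occupiedLabels_le_longestMonotone {N : ℕ} (A : HDPerm n k)
    (c : Fin (k + 1) × Fin n → Fin N) :
    (occupiedLabels A.supportFinset c).card ≤ (permute (sortPerm c) A).longestMonotone := by
  set e := (occupiedLabels A.supportFinset c).orderEmbOfFin rfl
  have he : ∀ l, ∃ x ∈ A.supportFinset, ∀ j, c (j, x j) = e l := fun l =>
    mem_occupiedLabels.1 (Finset.orderEmbOfFin_mem _ rfl l)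
  choose x hx hxc using he
  refine le_longestMonotone _ (s := fun l j => sortPerm c j (x l j))
    ⟨fun l => ?_, fun j => Or.inl fun l l' hl => ?_⟩
  · rw [mem_support_permute]
    simpa using mem_supportFinset.1 (hx l)
  · apply sortPerm_lt
    rw [hxc, hxc]
    exact e.strictMono hl

/-- The points with coordinate sum $0$ modulo $n$ form the support of such an array. -/
theorem nonempty_of_pos (hn : 0 < n) : Nonempty (HDPerm n k) := by
  have : NeZero n := ⟨hn.ne'⟩
  refine ⟨⟨fun x => if ∑ j, x j = 0 then 1 else 0, ?_⟩⟩
  intro j x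
  have h : ∀ t, ∑ i, Function.update x j t i = t + ∑ i ∈ Finset.univ \ {j}, x i := by
    intro t
    exact Finset.sum_update_of_mem (Finset.mem_univ j) x t
  refine ⟨-∑ i ∈ Finset.univ \ {j}, x i, ?_, ?_⟩
  · change (if _ then _ else _ : Fin 2) = 1
    rw [h, if_pos (neg_add_cancel _)]
  · intro t ht
    change (if _ then _ else _ : Fin 2) = 1 at ht
    rw [h] at ht
    split_ifs at ht with h0
    · exact eq_neg_of_add_eq_zero_left h0
    · exact absurd ht (by decide)

end HDPerm

/-! ### First moment and the two tail bounds -/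

theorem StrictMono.eq_of_comp_perm_eq {m n : ℕ} {f g : Fin m → Fin n} (hf : StrictMono f)
    (hg : StrictMono g) {τ τ' : Equiv.Perm (Fin m)} (h : f ∘ τ = g ∘ τ') : f = g ∧ τ = τ' := by
  have hfg : f = g := by
    rw [← StrictMono.range_inj hf hg, ← EquivLike.range_comp f τ, h, EquivLike.range_comp]
  subst hfg
  exact ⟨rfl, Equiv.ext fun a => hf.injective (congrFun h a)⟩

open Classical in
-- Of the $m!$ rearrangements of the values on $t$ only one is increasing. Precomposing $\sigma$
-- with $\tau$ extended along $t$ therefore gives an injection of pairs $(\sigma,\tau)$ into the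
-- permutations of $[n]$.
theorem card_filter_strictMono_comp_mul_factorial_le {m n : ℕ} (t : Fin m → Fin n) :
    (Finset.univ.filter fun σ : Equiv.Perm (Fin n) => StrictMono fun i => σ (t i)).card *
      m.factorial ≤ n.factorial := by
  by_cases ht : Function.Injective t
  · have h1 : m.factorial = (Finset.univ : Finset (Equiv.Perm (Fin m))).card := by
      rw [Finset.card_univ, Fintype.card_perm, Fintype.card_fin]
    have h2 : n.factorial = (Finset.univ : Finset (Equiv.Perm (Fin n))).card := by
      rw [Finset.card_univ, Fintype.card_perm, Fintype.card_fin]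
    rw [h1, h2, ← Finset.card_product]
    refine Finset.card_le_card_of_injOn
      (fun p => p.1 * p.2.viaFintypeEmbedding ⟨t, ht⟩) (fun _ _ => Finset.mem_univ _) ?_
    rintro ⟨σ, τ⟩ hp ⟨σ', τ'⟩ hp' h
    simp only [Finset.coe_product, Set.mem_prod, Finset.coe_filter, Finset.mem_univ, true_and,
      Set.mem_ofPred_eq] at hp hp'
    have hcomp : (fun i => σ (t i)) ∘ τ = (fun i => σ' (t i)) ∘ τ' := by
      funext a
      have := Equiv.congr_fun h (t a)
      have e1 := Equiv.Perm.viaFintypeEmbedding_apply_image τ ⟨t, ht⟩ a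
      have e2 := Equiv.Perm.viaFintypeEmbedding_apply_image τ' ⟨t, ht⟩ a
      simp only [Function.Embedding.coeFn_mk] at e1 e2
      simpa only [Equiv.Perm.mul_apply, Function.comp_apply, e1, e2] using this
    obtain ⟨-, rfl⟩ := StrictMono.eq_of_comp_perm_eq hp.1 hp'.1 hcomp
    exact Prod.ext (mul_right_cancel h) rfl
  · rw [Finset.card_eq_zero.2, zero_mul]
    · exact Nat.zero_le _
    · refine Finset.filter_eq_empty_iff.2 fun σ _ hσ => ht fun a b hab => ?_
      exact hσ.injective (congrArg σ hab)

open Classical in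
theorem card_filter_strictAnti_comp_mul_factorial_le {m n : ℕ} (t : Fin m → Fin n) :
    (Finset.univ.filter fun σ : Equiv.Perm (Fin n) => StrictAnti fun i => σ (t i)).card *
      m.factorial ≤ n.factorial := by
  refine le_trans (Nat.mul_le_mul_right _ (Finset.card_le_card ?_))
    (card_filter_strictMono_comp_mul_factorial_le (t ∘ Fin.rev))
  intro σ hσ
  simp only [Finset.mem_filter, Finset.mem_univ, true_and] at hσ ⊢
  exact hσ.comp Fin.rev_strictAnti

namespace HDPerm

variable {n k : ℕ}

instance : MeasurableSingletonClass (HDPerm n k) := ⟨fun _ => trivial⟩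

noncomputable instance : Fintype (HDPerm n k) := Fintype.ofFinite _

open Classical in
-- A union bound over the direction patterns `d` and the sequences `s` in the support of the
-- original $A$; for fixed `d` and `s` the conditions on the $\pi_j$ are independent.
theorem card_filter_le_longestMonotone_permute (hn : 0 < n) (A : HDPerm n k) (m : ℕ) :
    ((Finset.univ.filter fun π : Fin (k + 1) → Equiv.Perm (Fin n) =>
        m ≤ (permute π A).longestMonotone).card : ℝ) ≤
      2 ^ (k + 1) * ((n : ℝ) ^ k) ^ m / (m.factorial : ℝ) ^ (k + 1) *
        (n.factorial : ℝ) ^ (k + 1) := by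
  set good : (Fin (k + 1) → Bool) → (Fin m → Fin (k + 1) → Fin n) → Fin (k + 1) →
      Finset (Equiv.Perm (Fin n)) := fun d s j =>
    if d j then Finset.univ.filter fun σ => StrictMono fun i => σ (s i j)
    else Finset.univ.filter fun σ => StrictAnti fun i => σ (s i j) with hgood
  have hsub : (Finset.univ.filter fun π : Fin (k + 1) → Equiv.Perm (Fin n) =>
      m ≤ (permute π A).longestMonotone) ⊆
      (Finset.univ : Finset (Fin (k + 1) → Bool)).biUnion fun d =>
        (Fintype.piFinset fun _ : Fin m => A.supportFinset).biUnion fun s =>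
          Fintype.piFinset (good d s) := by
    intro π hπ
    simp only [Finset.mem_filter, Finset.mem_univ, true_and] at hπ
    obtain ⟨s, hs, hmono⟩ := exists_isMonotoneSubseq_of_le _ hπ
    simp only [Finset.mem_biUnion, Finset.mem_univ, true_and, Fintype.mem_piFinset]
    refine ⟨fun j => decide (StrictMono fun i => s i j), fun i j => (π j).symm (s i j),
      fun i => mem_supportFinset.2 (mem_support_permute.1 (hs i)), fun j => ?_⟩
    by_cases hj : StrictMono fun i => s i j
    · simp [hgood, hj]
    · simp [hgood, hj, (hmono j).resolve_left hj]
  have hfac : (0 : ℝ) < m.factorial := by exact_mod_cast m.factorial_pos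
  have hbound : ∀ d s j, ((good d s j).card : ℝ) ≤ (n.factorial : ℝ) / m.factorial := by
    intro d s j
    rw [le_div_iff₀ hfac]
    have : (good d s j).card * m.factorial ≤ n.factorial := by
      simp only [hgood]
      split_ifs
      · exact card_filter_strictMono_comp_mul_factorial_le fun i => s i j
      · exact card_filter_strictAnti_comp_mul_factorial_le fun i => s i j
    exact_mod_cast this
  calc ((Finset.univ.filter fun π : Fin (k + 1) → Equiv.Perm (Fin n) =>
        m ≤ (permute π A).longestMonotone).card : ℝ)
      ≤ ∑ d : Fin (k + 1) → Bool, ∑ s ∈ Fintype.piFinset fun _ : Fin m => A.supportFinset,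
          ((Fintype.piFinset (good d s)).card : ℝ) := by
        have h := (Finset.card_le_card hsub).trans (Finset.card_biUnion_le.trans
          (Finset.sum_le_sum fun d _ => Finset.card_biUnion_le))
        exact_mod_cast h
    _ ≤ ∑ d : Fin (k + 1) → Bool, ∑ s ∈ Fintype.piFinset fun _ : Fin m => A.supportFinset,
          ((n.factorial : ℝ) / m.factorial) ^ (k + 1) := by
        refine Finset.sum_le_sum fun d _ => Finset.sum_le_sum fun s _ => ?_
        rw [Fintype.card_piFinset, Nat.cast_prod]
        refine (Finset.prod_le_prod (fun _ _ => Nat.cast_nonneg _) fun j _ => hbound d s j).trans_eq ?_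
        rw [Finset.prod_const, Finset.card_univ, Fintype.card_fin]
    _ = _ := by
        simp only [Finset.sum_const, Fintype.card_piFinset, Finset.prod_const, Finset.card_univ,
          Fintype.card_fin, card_supportFinset hn, nsmul_eq_mul, Fintype.card_pi, Fintype.card_bool]
        push_cast
        rw [div_pow]
        ring

theorem unif_real_le_longestMonotone (hn : 0 < n) (m : ℕ) :
    (unif n k).real {A | m ≤ A.longestMonotone} ≤
      2 ^ (k + 1) * ((n : ℝ) ^ k) ^ m / (m.factorial : ℝ) ^ (k + 1) := by
  classical
  refine uniformOn_univ_real_le_of_perm permute _ (by positivity) fun A => ?_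
  refine (card_filter_le_longestMonotone_permute hn A m).trans_eq ?_
  rw [Fintype.card_fun, Fintype.card_perm]
  simp

theorem unif_real_longestMonotone_lt (hn : 0 < n) {N : ℕ} (hN : 0 < N) {δ : ℝ} (hδ : 0 < δ) :
    (unif n k).real {A | (A.longestMonotone : ℝ) < N * ((n : ℝ) ^ k /
      ((N : ℝ) ^ (k + 1) + (n : ℝ) ^ k * (1 + (N : ℝ) / n) ^ (k + 1)) - δ)} ≤
      1 / (N * δ ^ 2) := by
  classical
  have : Nonempty (Fin N) := ⟨⟨0, hN⟩⟩
  refine uniformOn_univ_real_le_of_perm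
    (fun c : Fin (k + 1) × Fin n → Fin N => permute (sortPerm c)) _ (by positivity) fun A => ?_
  have h := card_filter_card_occupiedLabels_lt (N := N) A.supportFinset hN hδ
    fun i => le_card_filter_mem_occupiedLabels A.supportFinset hn i (card_supportFinset hn A)
      fun x _ S hS => card_filter_supportFinset_mul_le A x hS
  have hcard : (Fintype.card (Fin (k + 1) × Fin n → Fin N) : ℝ) = (N : ℝ) ^ ((k + 1) * n) := by
    simp
  rw [hcard]
  refine le_trans ?_ h
  refine Nat.cast_le.2 (Finset.card_le_card fun c hc => ?_)
  simp only [Finset.mem_filter, Finset.mem_univ, true_and, Set.mem_ofPred_eq] at hc ⊢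
  refine lt_of_le_of_lt ?_ hc
  exact_mod_cast card_occupiedLabels_le_longestMonotone A c

end HDPerm

/-! ### Asymptotics of the tails -/

namespace HDPerm

section Tails

variable {k : ℕ}

theorem rpow_div_add_one_pow (k n : ℕ) :
    ((n : ℝ) ^ ((k : ℝ) / (k + 1))) ^ (k + 1) = (n : ℝ) ^ k := by
  rw [← Real.rpow_natCast, ← Real.rpow_mul (Nat.cast_nonneg n)]
  push_cast
  rw [div_mul_cancel₀ _ (by positivity), Real.rpow_natCast]

theorem tendsto_natCast_rpow_div_add_one (hk : 1 ≤ k) :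
    Tendsto (fun n : ℕ => (n : ℝ) ^ ((k : ℝ) / (k + 1))) atTop atTop := by
  have hk' : (0 : ℝ) < k := by exact_mod_cast hk
  exact (tendsto_rpow_atTop (by positivity)).comp tendsto_natCast_atTop_atTop

theorem scaledLongest_eq_div {n : ℕ} (A : HDPerm n k) :
    A.scaledLongest = (A.longestMonotone : ℝ) / (n : ℝ) ^ ((k : ℝ) / (k + 1)) := by
  rw [scaledLongest, Real.rpow_neg (Nat.cast_nonneg n), ← div_eq_mul_inv]

theorem scaledLongest_nonneg {n : ℕ} (A : HDPerm n k) : 0 ≤ A.scaledLongest := by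
  rw [scaledLongest_eq_div]
  positivity

theorem scaledLongest_le {n : ℕ} (hn : 0 < n) (A : HDPerm n k) : A.scaledLongest ≤ n := by
  have h1 : (1 : ℝ) ≤ n := by exact_mod_cast hn
  have h2 : (1 : ℝ) ≤ (n : ℝ) ^ ((k : ℝ) / (k + 1)) := Real.one_le_rpow h1 (by positivity)
  rw [scaledLongest_eq_div]
  refine (div_le_self (Nat.cast_nonneg _) h2).trans ?_
  exact_mod_cast A.longestMonotone_le

theorem unif_real_lt_scaledLongest {n : ℕ} (hn : 0 < n) {ε : ℝ} (hε : 0 < ε) :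
    (unif n k).real {A | Real.exp 1 + ε < A.scaledLongest} ≤
      2 ^ (k + 1) * Real.exp (-Real.log ((Real.exp 1 + ε) / Real.exp 1) *
        (n : ℝ) ^ ((k : ℝ) / (k + 1))) := by
  have he : 0 < Real.exp 1 := Real.exp_pos 1
  set y : ℝ := (n : ℝ) ^ ((k : ℝ) / (k + 1)) with hy
  have hypos : 0 < y := Real.rpow_pos_of_pos (by exact_mod_cast hn) _
  set q : ℝ := (Real.exp 1 + ε) / Real.exp 1 with hq
  have hq1 : 1 < q := by rw [hq, one_lt_div he]; linarith
  have hb : 0 < Real.log q := Real.log_pos hq1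
  set m : ℕ := ⌈(Real.exp 1 + ε) * y⌉₊ with hm
  have hmy : (Real.exp 1 + ε) * y ≤ m := Nat.le_ceil _
  have hym : y ≤ m := by
    have : 1 ≤ Real.exp 1 := Real.one_le_exp zero_le_one
    nlinarith
  have hfac : (0 : ℝ) < m.factorial := by exact_mod_cast m.factorial_pos
  have hsub : {A : HDPerm n k | Real.exp 1 + ε < A.scaledLongest} ⊆
      {A | m ≤ A.longestMonotone} := by
    intro A hA
    rw [Set.mem_ofPred_eq, scaledLongest_eq_div, lt_div_iff₀ hypos] at hA
    exact Nat.ceil_le.2 hA.le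
  have : IsFiniteMeasure (unif n k) := by unfold unif; infer_instance
  refine (measureReal_mono hsub).trans ((unif_real_le_longestMonotone hn m).trans ?_)
  -- Uses $y\le m/(e+\varepsilon)$ and $m^m/m!\le e^m$, leaving $q^{-m}$ with
  -- $q=(e+\varepsilon)/e>1$.
  have hkey : y ^ m / m.factorial ≤ Real.exp (-Real.log q * y) := by
    calc y ^ m / m.factorial ≤ (m / (Real.exp 1 + ε)) ^ m / m.factorial := by
          gcongr
          rw [le_div_iff₀ (by positivity)]
          linarith
      _ = ((m : ℝ) ^ m / m.factorial) / (Real.exp 1 + ε) ^ m := by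
          rw [div_pow]; ring
      _ ≤ Real.exp m / (Real.exp 1 + ε) ^ m := by
          gcongr
          exact Real.pow_div_factorial_le_exp _ (Nat.cast_nonneg m) m
      _ = (q ^ m)⁻¹ := by
          rw [hq, div_pow, inv_div, ← Real.exp_nat_mul, mul_one]
      _ = Real.exp (-Real.log q * m) := by
          rw [neg_mul, Real.exp_neg, mul_comm, Real.exp_nat_mul, Real.exp_log (by linarith)]
      _ ≤ _ := by
          apply Real.exp_le_exp.2
          nlinarith
  have h1 : Real.exp (-Real.log q * y) ≤ 1 := by
    rw [Real.exp_le_one_iff]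
    nlinarith
  rw [← rpow_div_add_one_pow k n, ← hy, mul_div_assoc]
  gcongr
  calc (y ^ (k + 1)) ^ m / (m.factorial : ℝ) ^ (k + 1) = (y ^ m / m.factorial) ^ (k + 1) := by
        rw [div_pow]; ring
    _ ≤ (Real.exp (-Real.log q * y)) ^ (k + 1) := by gcongr
    -- One of the $k+1$ equal factors suffices.
    _ ≤ _ := pow_le_of_le_one (Real.exp_pos _).le h1 (Nat.succ_ne_zero k)

/-- The extra factor $n$, a trivial bound for `scaledLongest`, is what the expectation requires. -/
theorem tendsto_mul_unif_real_lt_scaledLongest (hk : 1 ≤ k) {ε : ℝ} (hε : 0 < ε) :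
    Tendsto (fun n : ℕ => (n : ℝ) * (unif n k).real {A | Real.exp 1 + ε < A.scaledLongest})
      atTop (𝓝 0) := by
  have hk' : (0 : ℝ) < k := by exact_mod_cast hk
  have hb : 0 < Real.log ((Real.exp 1 + ε) / Real.exp 1) := by
    apply Real.log_pos
    rw [one_lt_div (Real.exp_pos 1)]
    linarith
  have h := ((tendsto_rpow_mul_exp_neg_mul_atTop_nhds_zero (((k : ℝ) + 1) / k) _ hb).comp
    (tendsto_natCast_rpow_div_add_one hk)).const_mul ((2 : ℝ) ^ (k + 1))
  rw [mul_zero] at h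
  refine squeeze_zero' (Eventually.of_forall fun n => by positivity) ?_ h
  filter_upwards [eventually_gt_atTop 0] with n hn
  simp only [Function.comp_apply]
  rw [← Real.rpow_mul (Nat.cast_nonneg n), div_mul_div_cancel₀ (by positivity), div_self hk'.ne',
    Real.rpow_one, mul_left_comm]
  gcongr
  exact unif_real_lt_scaledLongest hn hε

/-- The limiting lower bound for the longest monotone subsequence given by the second moment. -/
noncomputable def secondMomentConst (k : ℕ) : ℝ :=
  (k : ℝ) ^ (-(1 / ((k : ℝ) + 1))) * (k / (k + 1))

theorem tendsto_unif_real_scaledLongest_lt (hk : 1 ≤ k) {κ : ℝ} (hκ : κ < secondMomentConst k) :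
    Tendsto (fun n : ℕ => (unif n k).real {A | A.scaledLongest < κ}) atTop (𝓝 0) := by
  have hk' : (0 : ℝ) < k := by exact_mod_cast hk
  -- With $N\approx by$ the bound is $b/(1+b^{k+1})$, maximal at $b^{k+1}=1/k$.
  set b : ℝ := (k : ℝ) ^ (-(1 / ((k : ℝ) + 1))) with hb
  have hbpos : 0 < b := Real.rpow_pos_of_pos hk' _
  have hbpow : b ^ (k + 1) = 1 / k := by
    rw [hb, ← Real.rpow_natCast, ← Real.rpow_mul hk'.le]
    push_cast
    rw [neg_mul, one_div_mul_cancel (by positivity), Real.rpow_neg_one, one_div]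
  set y : ℕ → ℝ := fun n => (n : ℝ) ^ ((k : ℝ) / (k + 1)) with hy
  have hytop : Tendsto y atTop atTop := tendsto_natCast_rpow_div_add_one hk
  set N : ℕ → ℕ := fun n => ⌊b * y n⌋₊ with hN
  have hNy : Tendsto (fun n => (N n : ℝ) / y n) atTop (𝓝 b) :=
    (tendsto_nat_floor_mul_div_atTop hbpos.le).comp hytop
  have hNtop : Tendsto (fun n => (N n : ℝ)) atTop atTop :=
    tendsto_natCast_atTop_atTop.comp
      (tendsto_nat_floor_atTop.comp (hytop.const_mul_atTop hbpos))
  have hyn : Tendsto (fun n : ℕ => y n / n) atTop (𝓝 0) := by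
    have h : Tendsto (fun n : ℕ => (n : ℝ) ^ (-(1 / ((k : ℝ) + 1)))) atTop (𝓝 0) :=
      (tendsto_rpow_neg_atTop (by positivity)).comp tendsto_natCast_atTop_atTop
    refine h.congr' ?_
    filter_upwards [eventually_gt_atTop 0] with n hn
    have hn' : (0 : ℝ) < n := by exact_mod_cast hn
    rw [hy, ← Real.rpow_sub_one hn'.ne']
    congr 1
    field_simp
    ring
  have hNn : Tendsto (fun n : ℕ => (N n : ℝ) / n) atTop (𝓝 0) := by
    have h := hNy.mul hyn
    rw [mul_zero] at h
    refine h.congr' ?_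
    filter_upwards [hytop.eventually_gt_atTop 0] with n hn
    rw [div_mul_div_cancel₀ hn.ne']
  set q : ℕ → ℝ := fun n => (n : ℝ) ^ k /
      ((N n : ℝ) ^ (k + 1) + (n : ℝ) ^ k * (1 + (N n : ℝ) / n) ^ (k + 1)) with hq
  have hqlim : Tendsto q atTop (𝓝 (k / (k + 1))) := by
    have h : Tendsto (fun n : ℕ => 1 / (((N n : ℝ) / y n) ^ (k + 1) +
        (1 + (N n : ℝ) / n) ^ (k + 1))) atTop
        (𝓝 (1 / (b ^ (k + 1) + (1 + 0) ^ (k + 1)))) := by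
      refine Tendsto.div tendsto_const_nhds
        ((hNy.pow _).add ((tendsto_const_nhds.add hNn).pow _)) ?_
      positivity
    have hlim : 1 / (b ^ (k + 1) + (1 + 0) ^ (k + 1)) = (k : ℝ) / (k + 1) := by
      rw [hbpow, add_zero, one_pow]
      field_simp
      ring
    rw [hlim] at h
    refine h.congr' ?_
    filter_upwards [eventually_gt_atTop 0] with n hn
    have hn' : (0 : ℝ) < n := by exact_mod_cast hn
    rw [hq, div_pow, hy, rpow_div_add_one_pow]
    field_simp
  -- The loss $b\delta$ is half the gap between $\kappa$ and the limiting constant.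
  set δ : ℝ := (secondMomentConst k - κ) / (2 * b) with hδ
  have hδpos : 0 < δ := div_pos (by linarith) (by positivity)
  have hlim : Tendsto (fun n => (N n : ℝ) / y n * (q n - δ)) atTop
      (𝓝 (b * (k / (k + 1) - δ))) := hNy.mul (hqlim.sub_const δ)
  have hlt : κ < b * (k / (k + 1) - δ) := by
    have : b * δ = (secondMomentConst k - κ) / 2 := by
      rw [hδ]; field_simp
    rw [mul_sub, this, show b * ((k : ℝ) / (k + 1)) = secondMomentConst k from rfl]
    linarith
  have hbound : Tendsto (fun n => 1 / ((N n : ℝ) * δ ^ 2)) atTop (𝓝 0) :=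
    tendsto_const_nhds.div_atTop (hNtop.atTop_mul_const (by positivity))
  refine squeeze_zero' (Eventually.of_forall fun n => measureReal_nonneg) ?_ hbound
  filter_upwards [eventually_gt_atTop 0, hNtop.eventually_gt_atTop 0,
    hlim.eventually (lt_mem_nhds hlt), hytop.eventually_gt_atTop 0] with n hn hNpos hlt hypos
  have : IsFiniteMeasure (unif n k) := by unfold unif; infer_instance
  refine (measureReal_mono ?_).trans
    (unif_real_longestMonotone_lt hn (by exact_mod_cast hNpos) hδpos)
  intro A hA
  rw [Set.mem_ofPred_eq, scaledLongest_eq_div] at hA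
  have h := hA.trans hlt
  rw [div_mul_eq_mul_div, div_lt_div_iff_of_pos_right hypos] at h
  exact h

/-- From $e^x\ge 1+x$ the constant is at least $(1-\frac{\ln k}{k+1})\frac{k}{k+1}$, which exceeds
the left side by $\ln k/(k+1)^2\ge 0$. -/
theorem le_secondMomentConst (hk : 1 ≤ k) :
    1 - (Real.log k + 1) / ((k : ℝ) + 1) ≤ secondMomentConst k := by
  have hk' : (0 : ℝ) < k := by exact_mod_cast hk
  have hlog : 0 ≤ Real.log k := Real.log_nonneg (by exact_mod_cast hk)
  have h := Real.add_one_le_exp (Real.log k * -(1 / ((k : ℝ) + 1)))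
  rw [← Real.rpow_def_of_pos hk'] at h
  have h2 : (Real.log k * -(1 / ((k : ℝ) + 1)) + 1) * (k / (k + 1)) ≤ secondMomentConst k := by
    unfold secondMomentConst
    gcongr
  refine le_trans ?_ h2
  rw [← sub_nonneg]
  have : (Real.log k * -(1 / ((k : ℝ) + 1)) + 1) * (k / (k + 1)) -
      (1 - (Real.log k + 1) / ((k : ℝ) + 1)) = Real.log k / ((k : ℝ) + 1) ^ 2 := by
    field_simp
    ring
  rw [this]
  positivity

theorem one_div_add_two_lt_secondMomentConst (hk : 1 ≤ k) :
    1 / ((k : ℝ) + 2) < secondMomentConst k := by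
  have hk' : (0 : ℝ) < k := by exact_mod_cast hk
  have hk1 : (1 : ℝ) ≤ k := by exact_mod_cast hk
  have h1 : (k : ℝ) ^ (-1 : ℝ) ≤ (k : ℝ) ^ (-(1 / ((k : ℝ) + 1))) := by
    apply Real.rpow_le_rpow_of_exponent_le hk1
    rw [neg_le_neg_iff, div_le_one (by positivity)]
    linarith
  calc 1 / ((k : ℝ) + 2) < 1 / ((k : ℝ) + 1) := by
        apply one_div_lt_one_div_of_lt <;> linarith
    _ = (k : ℝ) ^ (-1 : ℝ) * (k / (k + 1)) := by
        rw [Real.rpow_neg_one]; field_simp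
    _ ≤ _ := by
        unfold secondMomentConst
        gcongr

end Tails

end HDPerm

/-! ### Expectation -/

namespace HDPerm

section Expectation

variable {k : ℕ}

theorem isProbabilityMeasure_unif {n : ℕ} (hn : 0 < n) : IsProbabilityMeasure (unif n k) := by
  have := nonempty_of_pos (k := k) hn
  exact isProbabilityMeasure_uniformOn Set.finite_univ Set.univ_nonempty

/-- Markov's inequality at a level $\kappa$ strictly between $t$ and the constant. -/
theorem eventually_lt_integral_scaledLongest (hk : 1 ≤ k) {t : ℝ}
    (ht : t < secondMomentConst k) :
    ∀ᶠ n : ℕ in atTop, t < ∫ A : HDPerm n k, A.scaledLongest ∂(unif n k) := by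
  obtain ⟨κ, htκ, hκ⟩ := exists_between ht
  have h : Tendsto (fun n : ℕ => κ * (1 - (unif n k).real {A | A.scaledLongest < κ})) atTop
      (𝓝 (κ * (1 - 0))) :=
    ((tendsto_unif_real_scaledLongest_lt hk hκ).const_sub 1).const_mul κ
  rw [sub_zero, mul_one] at h
  filter_upwards [h.eventually (lt_mem_nhds htκ), eventually_gt_atTop 0] with n hlt hn
  have := isProbabilityMeasure_unif (k := k) hn
  refine hlt.trans_le ?_
  have hc : {A : HDPerm n k | κ ≤ A.scaledLongest} = {A | A.scaledLongest < κ}ᶜ := by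
    ext A; simp
  have hm := mul_meas_ge_le_integral_of_nonneg (μ := unif n k)
    (Eventually.of_forall fun A : HDPerm n k => A.scaledLongest_nonneg) Integrable.of_finite κ
  rw [hc, probReal_compl_eq_one_sub (Set.toFinite _).measurableSet] at hm
  exact hm

/-- For $e<u<t$ the variable is at most $u$ off the upper tail and at most $n$ on it. -/
theorem eventually_integral_scaledLongest_lt (hk : 1 ≤ k) {t : ℝ} (ht : Real.exp 1 < t) :
    ∀ᶠ n : ℕ in atTop, ∫ A : HDPerm n k, A.scaledLongest ∂(unif n k) < t := by
  obtain ⟨u, hu, hut⟩ := exists_between ht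
  have hε : 0 < u - Real.exp 1 := sub_pos.2 hu
  have h := (tendsto_mul_unif_real_lt_scaledLongest hk hε).const_add u
  rw [add_zero] at h
  filter_upwards [h.eventually (gt_mem_nhds hut), eventually_gt_atTop 0] with n hlt hn
  rw [add_sub_cancel] at hlt
  have := isProbabilityMeasure_unif (k := k) hn
  refine lt_of_le_of_lt ?_ hlt
  have hS : MeasurableSet {A : HDPerm n k | u < A.scaledLongest} := (Set.toFinite _).measurableSet
  calc ∫ A : HDPerm n k, A.scaledLongest ∂(unif n k)
      ≤ ∫ A : HDPerm n k, (u + {A : HDPerm n k | u < A.scaledLongest}.indicator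
          (fun _ => (n : ℝ)) A) ∂(unif n k) := by
        refine integral_mono Integrable.of_finite Integrable.of_finite fun A => ?_
        by_cases hA : u < A.scaledLongest
        · have h1 := scaledLongest_le hn A
          have h2 : 0 < u := (Real.exp_pos 1).trans hu
          simp only [Set.indicator, Set.mem_ofPred_eq, hA, if_true]
          linarith
        · simp only [Set.indicator, Set.mem_ofPred_eq, hA, if_false]
          linarith
    _ = _ := by
        rw [integral_add Integrable.of_finite Integrable.of_finite, integral_const,
          integral_indicator_const _ hS]
        simp [mul_comm]

end Expectation

end HDPerm

/-! ### Main theorem -/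

theorem mainTheorem3 (k : ℕ) (hk : 1 ≤ k) :
    (∀ ε : ℝ, 0 < ε →
      Tendsto
        (fun n : ℕ => (HDPerm.unif n k).real
          {A : HDPerm n k |
            A.scaledLongest ∈ Set.Icc (1 / ((k : ℝ) + 2)) (Real.exp 1 + ε)})
        atTop (𝓝 1)) ∧
    ∃ δ₁ δ₂ : ℕ → ℝ, Tendsto δ₁ atTop (𝓝 0) ∧ Tendsto δ₂ atTop (𝓝 0) ∧
      ∀ n : ℕ, 1 ≤ n →
        1 - (Real.log k + 1) / ((k : ℝ) + 1) - δ₁ n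
            ≤ ∫ A : HDPerm n k, A.scaledLongest ∂(HDPerm.unif n k) ∧
        ∫ A : HDPerm n k, A.scaledLongest ∂(HDPerm.unif n k) ≤ Real.exp 1 + δ₂ n := by
  constructor
  · intro ε hε
    have hlow := HDPerm.tendsto_unif_real_scaledLongest_lt hk
      (HDPerm.one_div_add_two_lt_secondMomentConst hk)
    have hup := HDPerm.tendsto_mul_unif_real_lt_scaledLongest hk hε
    have hlim := (hlow.add hup).const_sub 1
    rw [add_zero, sub_zero] at hlim
    refine tendsto_of_tendsto_of_tendsto_of_le_of_le' hlim tendsto_const_nhds ?_ ?_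
    · filter_upwards [eventually_gt_atTop 0] with n hn
      have := HDPerm.isProbabilityMeasure_unif (k := k) hn
      set G := {A : HDPerm n k |
        A.scaledLongest ∈ Set.Icc (1 / ((k : ℝ) + 2)) (Real.exp 1 + ε)} with hG
      have hsub : Gᶜ ⊆ {A : HDPerm n k | A.scaledLongest < 1 / ((k : ℝ) + 2)} ∪
          {A | Real.exp 1 + ε < A.scaledLongest} := by
        intro A hA
        simp only [hG, Set.mem_compl_iff, Set.mem_ofPred_eq, Set.mem_Icc, not_and_or, not_le] at hA
        exact hA
      have hle := (measureReal_mono (μ := HDPerm.unif n k) hsub).trans (measureReal_union_le _ _)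
      rw [probReal_compl_eq_one_sub (Set.toFinite _).measurableSet] at hle
      have h1 : (1 : ℝ) ≤ n := by exact_mod_cast hn
      have h2 := le_mul_of_one_le_left (measureReal_nonneg (μ := HDPerm.unif n k)
        (s := {A | Real.exp 1 + ε < A.scaledLongest})) h1
      linarith
    · filter_upwards [eventually_gt_atTop 0] with n hn
      have := HDPerm.isProbabilityMeasure_unif (k := k) hn
      exact measureReal_le_one
  · set E : ℕ → ℝ := fun n => ∫ A : HDPerm n k, A.scaledLongest ∂(HDPerm.unif n k)
    set L : ℝ := 1 - (Real.log k + 1) / ((k : ℝ) + 1)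
    -- The errors are the positive parts of the deficits, so both inequalities hold for every $n$
    -- and only the limits need proof.
    refine ⟨fun n => max 0 (L - E n), fun n => max 0 (E n - Real.exp 1), ?_, ?_, fun n _ => ⟨?_, ?_⟩⟩
    · refine tendsto_order.2 ⟨fun a ha => Eventually.of_forall fun n => ha.trans_le (le_max_left _ _),
        fun a ha => ?_⟩
      filter_upwards [HDPerm.eventually_lt_integral_scaledLongest hk
        (show L - a < _ by linarith [HDPerm.le_secondMomentConst hk])] with n hn
      exact max_lt ha (by linarith)
    · refine tendsto_order.2 ⟨fun a ha => Eventually.of_forall fun n => ha.trans_le (le_max_left _ _),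
        fun a ha => ?_⟩
      filter_upwards [HDPerm.eventually_integral_scaledLongest_lt hk
        (show Real.exp 1 < Real.exp 1 + a by linarith)] with n hn
      exact max_lt ha (by linarith)
    · linarith [le_max_right 0 (L - E n)]
    · linarith [le_max_right 0 (E n - Real.exp 1)]
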